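/- Let $(K,d)$ be a nonempty compact metric space and let $f:K\to K$ be a Ruelle-expanding map, i.e. $f$ is continuous and there are $\rho>0$, $0<\lambda<1$, $c>0$ such that (i) $x\neq y$ and $f(x)=f(y)$ imply $d(x,y)>c$; (ii) for all $x\in K$ and $a\in f^{-1}(\{x\})$ there is $\varphi:B_\rho(x)\to K$ (where $B_\rho(x)$ is the open ball) with $\varphi(x)=a$, $f(\varphi(y))=y$ and $d(\varphi(y),\varphi(z))\le\lambda\, d(y,z)$ for all $y,z\in B_\rho(x)$. Fix such constants, and let $\varepsilon$ be an expansive constant for $f$: if $d(f^n(x),f^n(y))\le\varepsilon$ for all $n\ge 0$, then $x=y$. Let $R_1,\dots,R_k$ be a cover of $K$ by sets such that * each $R_i$ has diameter less than $\min\{\varepsilon,c/2\}$ and is the closure of its interior $\mathring R_i$; * $\mathring R_i\cap\mathring R_j=\emptyset$ for $i\ne j$; * if $f(\mathring R_i)\cap\mathring R_j\neq\emptyset$, then $\mathring R_j\subseteq f(\mathring R_i)$. Let $A_{ij}=1$ if $f(\mathring R_i)\cap\mathring R_j\ne\emptyset$ and $A_{ij}=0$ otherwise. For $1\le r\le k$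 let $I_r$ be the set of all $r$-element subsets $s=\{s_1<\dots<s_r\}$ of $\{1,\dots,k\}$ with $R_{s_1}\cap\dots\cap R_{s_r}\neq\emptyset$, and let $B^{(r)}$ be the matrix indexed by $I_r\times I_r$ with $B^{(r)}_{st}=\operatorname{sgn}(\mu)$ if there is a unique permutation $\mu\in S_r$ such that $A_{s_i t_{\mu(i)}}=1$ for all $i\in\{1,\dots,r\}$, and $B^{(r)}_{st}=0$ otherwise. Then there is a largest $L\in\{1,\dots,k\}$ with $I_L\ne\emptyset$, one has $I_r\neq\emptyset$ for all $1\le r\le L$, and for every integer $p\ge 1$ the number $N_p(f)$ of points $x\in K$ with $f^p(x)=x$ is finite and $$N_p(f)=\sum_{r=1}^{L}(-1)^{r-1}\operatorname{tr}\big((B^{(r)})^p\big).$$ -/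

import Mathlib

/-- `f` is a Ruelle-expanding map of the compact metric space `K`, with constants `r`, `lam`, `c`.
A local inverse branch `φ : B_r(x) → K` is represented by a function on `K` of which only the
values on the open ball `B_r(x)` are constrained. -/
structure IsRuelleExpandingWith {K : Type*} [MetricSpace K] (r lam c : ℝ) (f : K → K) : Prop where
  continuous : Continuous f
  r_pos : 0 < r
  lam_pos : 0 < lam
  lam_lt_one : lam < 1
  c_pos : 0 < c
  separated : ∀ x y : K, x ≠ y → f x = f y → c < dist x y
  branch : ∀ x a : K, f a = x → ∃ φ : K → K, φ x = a ∧
    (∀ y ∈ Metric.ball x r, f (φ y) = y) ∧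
    (∀ y ∈ Metric.ball x r, ∀ z ∈ Metric.ball x r, dist (φ y) (φ z) ≤ lam * dist y z)

/-- `ε` is an expansive constant for `f`. -/
def IsExpansiveConstant {K : Type*} [MetricSpace K] (f : K → K) (ε : ℝ) : Prop :=
  ∀ x y : K, (∀ n : ℕ, dist (f^[n] x) (f^[n] y) ≤ ε) → x = y

/-- The finite family of rectangles `R` is a Markov partition of `K` for `f`, relative to the
expansive constant `ε` and the separation constant `c`. -/
structure IsMarkovPartition {K : Type*} [MetricSpace K] (f : K → K) (ε c : ℝ) {k : ℕ}
    (R : Fin k → Set K) : Prop where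
  cover : ⋃ i, R i = Set.univ
  diam_lt : ∀ i, Metric.diam (R i) < min ε (c / 2)
  proper : ∀ i, R i = closure (interior (R i))
  disjoint : ∀ i j, i ≠ j → interior (R i) ∩ interior (R j) = ∅
  markov : ∀ i j, (f '' interior (R i) ∩ interior (R j)).Nonempty →
    interior (R j) ⊆ f '' interior (R i)

open Classical in
/-- The transition matrix `A`: `A i j = 1` if `f (int R_i)` meets `int R_j`, else `0`. -/
noncomputable def transitionMatrix {K : Type*} [MetricSpace K] (f : K → K) {k : ℕ}
    (R : Fin k → Set K) : Matrix (Fin k) (Fin k) ℤ :=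
  fun i j => if (f '' interior (R i) ∩ interior (R j)).Nonempty then 1 else 0

open Classical in
/-- `I_r`: the `r`-element sets of indices whose rectangles have a common point. -/
noncomputable def intersectingSets {K : Type*} {k : ℕ} (R : Fin k → Set K) (r : ℕ) :
    Finset (Finset (Fin k)) :=
  {s ∈ Finset.powersetCard r Finset.univ | (⋂ i ∈ s, R i).Nonempty}

theorem card_of_mem_intersectingSets {K : Type*} {k : ℕ} {R : Fin k → Set K} {r : ℕ}
    {s : Finset (Fin k)} (hs : s ∈ intersectingSets R r) : s.card = r := by
  classical
  unfold intersectingSets at hs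
  rw [Finset.mem_filter] at hs
  exact (Finset.mem_powersetCard.mp hs.1).2

/-- The elements of `s ∈ I_r` in increasing order, `s_1 < ⋯ < s_r`. -/
noncomputable def enumSet {K : Type*} {k : ℕ} {R : Fin k → Set K} {r : ℕ}
    (s : intersectingSets R r) : Fin r → Fin k :=
  s.1.orderEmbOfFin (card_of_mem_intersectingSets s.2)

open Classical in
/-- The signed transition matrix `B^{(r)}`: the entry at `(s, t)` is `sgn μ` if `μ` is the unique
permutation with `A (s_i) (t_{μ i}) = 1` for all `i`, and `0` if there is no unique such
permutation. -/
noncomputable def signedTransitionMatrix {K : Type*} [MetricSpace K] (f : K → K) {k : ℕ}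
    (R : Fin k → Set K) (r : ℕ) :
    Matrix (intersectingSets R r) (intersectingSets R r) ℤ :=
  fun s t =>
    if h : ∃! μ : Equiv.Perm (Fin r),
        ∀ i, transitionMatrix f R (enumSet s i) (enumSet t (μ i)) = 1
    then ((Equiv.Perm.sign h.choose : ℤˣ) : ℤ)
    else 0

/-!
# Counting periodic points with a Markov partition

Write `S(x)` for the set of rectangles containing `x`. The formula rests on one fact about a single
step of the dynamics: every rectangle `R_b ∋ f x` has exactly one predecessor `R_a ∋ x`, that is,
exactly one `a ∈ S(x)` with `A a b = 1`. Existence (`IsMarkovPartition.exists_predecessor`) holds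
because `f` is open; uniqueness (`IsMarkovPartition.eq_of_transition`) because `f` is injective on
the union of two rectangles with a common point, each having diameter less than `c / 2`.

Uniqueness of predecessors shows that at most one term of the Leibniz formula for the minor of `A`
at a pair `(s, t)` of sets in `I_r` is nonzero, so `B^(r)` is the part of the `r`-th compound
matrix of `A` with indices in `I_r` (`IsMarkovPartition.signedTransitionMatrix_eq_compound`).
Expand `tr ((B^(r))^p)` as a sum over closed paths `w_0, …, w_p = w_0` in `I_r`. If such a path has
nonzero weight, common points of the rectangles in `w_{i+1}` pull back to common points of those in
`w_i`. By compactness and expansivity, exactly one point `x` satisfies `w_i ⊆ S(f^i x)` for all `i`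
(with the path continued periodically), and `f^p x = x`
(`IsMarkovPartition.existsUnique_of_closedPath`). Hence the trace is the sum over the points `x`
fixed by `f^p` of the weights of the closed paths carried by `x`.

For a fixed `x`, the weights of the paths carried by `x` come from the matrices `N_i`, obtained from
`A` by keeping the rows in `S(f^i x)` and the columns in `S(f^(i+1) x)`. By the Cauchy–Binet formula
their sum is the trace of the `r`-th compound matrix of `G = N_0 ⋯ N_{p-1}`, and the alternating sum
over all `r ≥ 0` of these traces is `det (1 - G)`. Existence and uniqueness of predecessors say that
multiplication by `N_i` on the right takes the indicator row vector of `S(f^i x)` to that of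
`S(f^(i+1) x)`. So `G` fixes the nonzero indicator of `S(x)`, the determinant vanishes, and, the
term with `r = 0` being `1`, the point `x` contributes exactly `1`
(`IsMarkovPartition.sum_trace_compound_localTransitionMatrix`).
-/

/-! ### Compound matrices -/

section Compound

variable {ι R : Type*} [CommRing R]

/-- The `q`-th compound matrix of `M`: its entry at a pair `(s, t)` of `q`-element sets of indices
is the minor of `M` with rows in `s` and columns in `t`, both listed in increasing order. -/
def Matrix.compound [LinearOrder ι] (q : ℕ) (M : Matrix ι ι R) :
    Matrix (Set.powersetCard ι q) (Set.powersetCard ι q) R :=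
  fun s t => (M.submatrix (s.1.orderEmbOfFin (Set.powersetCard.card_eq s))
    (t.1.orderEmbOfFin (Set.powersetCard.card_eq t))).det

/-- The compound matrix is the matrix of the `q`-th exterior power. -/
theorem Matrix.compound_eq_toMatrix [LinearOrder ι] [Fintype ι] (q : ℕ) (M : Matrix ι ι R) :
    M.compound q = LinearMap.toMatrix ((Pi.basisFun R ι).exteriorPower q)
      ((Pi.basisFun R ι).exteriorPower q) (exteriorPower.map q (Matrix.toLin' M)) := by
  ext s t
  rw [LinearMap.toMatrix_apply, exteriorPower.basis_apply, exteriorPower.basis_repr_apply,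
    exteriorPower.map_apply_ιMulti_family, exteriorPower.ιMulti_family,
    exteriorPower.ιMultiDual_apply_ιMulti, Matrix.compound, ← Matrix.det_transpose]
  congr 1
  ext i j
  simp [Set.powersetCard.ofFinEmbEquiv_symm_apply]

/-- The Cauchy–Binet formula, deduced from the functoriality of exterior powers. -/
theorem Matrix.compound_mul [LinearOrder ι] [Fintype ι] (q : ℕ) (M N : Matrix ι ι R) :
    (M * N).compound q = M.compound q * N.compound q := by
  rw [Matrix.compound_eq_toMatrix, Matrix.compound_eq_toMatrix, Matrix.compound_eq_toMatrix,
    ← LinearMap.toMatrix_comp, Matrix.toLin'_mul, exteriorPower.map_comp]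

theorem Matrix.compound_one [LinearOrder ι] [Fintype ι] (q : ℕ) :
    (1 : Matrix ι ι R).compound q = 1 := by
  rw [Matrix.compound_eq_toMatrix, Matrix.toLin'_one, exteriorPower.map_id,
    LinearMap.toMatrix_id]

theorem Matrix.compound_list_prod [LinearOrder ι] [Fintype ι] (q : ℕ) (l : List (Matrix ι ι R)) :
    l.prod.compound q = (l.map (Matrix.compound q)).prod := by
  induction l with
  | nil => simp [Matrix.compound_one]
  | cons M l ih => simp [Matrix.compound_mul, ih]

theorem Matrix.trace_compound [LinearOrder ι] [Fintype ι] (q : ℕ) (M : Matrix ι ι R) :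
    (M.compound q).trace = ∑ s ∈ Finset.univ.powersetCard q,
      (M.submatrix (Subtype.val : s → ι) (Subtype.val : s → ι)).det := by
  rw [Matrix.trace]
  refine Finset.sum_bij (fun s _ => s.1) (fun s _ => by simp)
    (fun s _ t _ h => Subtype.ext h) (fun s hs => ⟨⟨s, by simpa using hs⟩, by simp, rfl⟩) ?_
  intro s _
  rw [Matrix.diag_apply, Matrix.compound, ← Matrix.det_submatrix_equiv_self
    (s.1.orderIsoOfFin (Set.powersetCard.card_eq s)).toEquiv, Matrix.submatrix_submatrix]
  rfl

/-- The alternating sum of the traces of the compound matrices is `det (1 - M)`. -/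
theorem Matrix.sum_neg_one_pow_mul_trace_compound [LinearOrder ι] [Fintype ι]
    (M : Matrix ι ι R) :
    ∑ q ∈ Finset.range (Fintype.card ι + 1), (-1) ^ q * (M.compound q).trace = (1 - M).det := by
  nontriviality R
  have h := M.eval_charpoly 1
  rw [map_one, Polynomial.eval_eq_sum_range, M.charpoly_natDegree_eq_dim,
    ← Finset.sum_range_reflect] at h
  rw [← h]
  refine Finset.sum_congr rfl fun q hq => ?_
  rw [Finset.mem_range] at hq
  rw [Matrix.trace_compound, one_pow, mul_one, add_tsub_cancel_right,
    Matrix.charpoly_coeff_eq_sum_minors M q (by omega)]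

/-- If a nonzero vector is fixed by `M` then the compound matrices of positive order have
alternating trace sum `1`. -/
theorem Matrix.sum_trace_compound_eq_one [LinearOrder ι] [Fintype ι] [IsDomain R]
    (M : Matrix ι ι R) {v : ι → R} (hv : v ≠ 0) (h : Matrix.vecMul v M = v) :
    ∑ q ∈ Finset.Icc 1 (Fintype.card ι), (-1) ^ (q - 1) * (M.compound q).trace = 1 := by
  have hdet : (1 - M).det = 0 := by
    rw [← Matrix.exists_vecMul_eq_zero_iff]
    exact ⟨v, hv, by rw [Matrix.vecMul_sub, h, Matrix.vecMul_one, sub_self]⟩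
  have hsum := M.sum_neg_one_pow_mul_trace_compound
  have h0 : (M.compound 0).trace = 1 := by simp [Matrix.trace_compound]
  rw [hdet, Finset.sum_range_succ', pow_zero, one_mul, h0] at hsum
  have hshift : ∑ q ∈ Finset.Icc 1 (Fintype.card ι), (-1) ^ (q - 1) * (M.compound q).trace =
      ∑ q ∈ Finset.range (Fintype.card ι), (-1) ^ q * (M.compound (q + 1)).trace := by
    rw [show Finset.Icc 1 (Fintype.card ι) = Finset.Ico 1 (Fintype.card ι + 1) by ext; simp,
      Finset.sum_Ico_eq_sum_range, Nat.add_sub_cancel]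
    refine Finset.sum_congr rfl fun q _ => ?_
    rw [add_comm 1 q, Nat.add_sub_cancel]
  rw [hshift]
  simp only [pow_succ, mul_neg_one, neg_mul, Finset.sum_neg_distrib] at hsum
  exact neg_add_eq_zero.mp hsum

end Compound

/-! ### Traces of products as sums over closed paths -/

section Paths

variable {ι R : Type*} [CommRing R] [Fintype ι] [DecidableEq ι]

theorem Matrix.list_prod_apply_eq_sum_paths (M : ℕ → Matrix ι ι R) (n : ℕ) (i j : ι) :
    ((List.range n).map M).prod i j = ∑ w : Fin (n + 1) → ι,
      if w 0 = i ∧ w (Fin.last n) = j then ∏ m : Fin n, M m (w m.castSucc) (w m.succ) else 0 := by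
  induction n generalizing j with
  | zero =>
    rw [← (Equiv.funUnique (Fin 1) ι).symm.sum_comp]
    simp [Matrix.one_apply, ite_and]
  | succ n ih =>
    rw [List.range_succ, List.map_append, List.prod_append, Matrix.mul_apply,
      ← (Fin.snocEquiv fun _ => ι).sum_comp, Fintype.sum_prod_type]
    simp only [List.map_cons, List.map_nil, List.prod_cons, List.prod_nil, mul_one, ih,
      Fin.snocEquiv_apply, Fin.snoc_last, Fin.prod_univ_castSucc, Fin.snoc_castSucc,
      Fin.succ_last, Finset.sum_mul]
    have h0 : ∀ (a : ι) (w : Fin (n + 1) → ι),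
        (Fin.snoc w a : Fin (n + 2) → ι) 0 = w 0 := fun a w =>
      Fin.snoc_castSucc (α := fun _ => ι) a w 0
    have h1 : ∀ (a : ι) (w : Fin (n + 1) → ι) (m : Fin n),
        (Fin.snoc w a : Fin (n + 2) → ι) m.castSucc.succ = w m.succ := fun a w m =>
      Fin.snoc_castSucc (α := fun _ => ι) a w m.succ
    simp only [h0, h1, ite_and]
    rw [Finset.sum_comm, Finset.sum_comm (s := Finset.univ (α := ι))]
    refine Finset.sum_congr rfl fun w _ => ?_
    by_cases hw : w 0 = i <;> simp [hw]

/-- The trace of a product of matrices is the sum over the closed paths of the products of the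
entries along the path. -/
theorem Matrix.trace_list_prod_eq_sum_paths (M : ℕ → Matrix ι ι R) (n : ℕ) :
    ((List.range n).map M).prod.trace = ∑ w : Fin (n + 1) → ι,
      if w 0 = w (Fin.last n) then ∏ m : Fin n, M m (w m.castSucc) (w m.succ) else 0 := by
  simp only [Matrix.trace, Matrix.diag_apply, Matrix.list_prod_apply_eq_sum_paths]
  rw [Finset.sum_comm]
  refine Finset.sum_congr rfl fun w _ => ?_
  simp [ite_and, eq_comm]

/-- Deleting indices whose rows vanish does not change the traces of the positive powers of a
matrix. -/
theorem Matrix.trace_submatrix_pow {κ : Type*} [Fintype κ] [DecidableEq κ] (M : Matrix ι ι R)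
    (e : κ ↪ ι) (hM : ∀ i j, i ∉ Set.range e → M i j = 0) {p : ℕ} (hp : p ≠ 0) :
    (M.submatrix e e ^ p).trace = (M ^ p).trace := by
  have hsum : ∀ g : ι → R, (∀ i, i ∉ Set.range e → g i = 0) → ∑ a, g (e a) = ∑ i, g i :=
    fun g hg => Fintype.sum_of_injective e e.injective _ _ hg fun _ => rfl
  have hrow : ∀ p : ℕ, p ≠ 0 → ∀ i j, i ∉ Set.range e → (M ^ p) i j = 0 := by
    intro p hp i j hi
    obtain ⟨n, rfl⟩ := Nat.exists_eq_succ_of_ne_zero hp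
    rw [pow_succ', Matrix.mul_apply]
    exact Finset.sum_eq_zero fun l _ => by rw [hM i l hi, zero_mul]
  have hpow : ∀ n : ℕ, M.submatrix e e ^ (n + 1) = (M ^ (n + 1)).submatrix e e := by
    intro n
    induction n with
    | zero => simp
    | succ n ih =>
      ext a b
      rw [pow_succ, ih, pow_succ M (n + 1), Matrix.mul_apply, Matrix.submatrix_apply,
        Matrix.mul_apply]
      exact hsum (fun l => (M ^ (n + 1)) (e a) l * M l (e b)) fun i hi => by
        rw [hM i _ hi, mul_zero]
  obtain ⟨n, rfl⟩ := Nat.exists_eq_succ_of_ne_zero hp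
  rw [Nat.succ_eq_add_one, hpow]
  exact hsum (fun i => (M ^ (n + 1)) i i) fun i hi => hrow _ n.succ_ne_zero i i hi

end Paths

/-! ### Ruelle-expanding maps -/

section Expanding

variable {K : Type*} [MetricSpace K] {f : K → K} {r lam c : ℝ}

theorem IsRuelleExpandingWith.eq_of_dist_le (hf : IsRuelleExpandingWith r lam c f) {x y : K}
    (hxy : f x = f y) (hd : dist x y ≤ c) : x = y := by
  by_contra hne
  exact (hf.separated x y hne hxy).not_ge hd

theorem IsRuelleExpandingWith.isOpenMap (hf : IsRuelleExpandingWith r lam c f) : IsOpenMap f := by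
  rw [isOpenMap_iff_nhds_le]
  intro a U hU
  obtain ⟨δ, hδ, hball⟩ := Metric.mem_nhds_iff.mp (Filter.mem_map.mp hU)
  obtain ⟨φ, hφa, hφ, hlip⟩ := hf.branch (f a) a rfl
  refine Metric.mem_nhds_iff.mpr ⟨min r δ, lt_min hf.r_pos hδ, fun y hy => ?_⟩
  have hyr : y ∈ Metric.ball (f a) r := Metric.ball_subset_ball (min_le_left _ _) hy
  have hyδ : dist y (f a) < δ := lt_of_lt_of_le hy (min_le_right _ _)
  have hd := hlip y hyr (f a) (Metric.mem_ball_self hf.r_pos)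
  rw [hφa] at hd
  have hlt : dist (φ y) a < δ := by
    nlinarith [hf.lam_pos, hf.lam_lt_one, dist_nonneg (x := y) (y := f a)]
  have hmem : φ y ∈ f ⁻¹' U := hball hlt
  rwa [Set.mem_preimage, hφ y hyr] at hmem

end Expanding

/-! ### Rectangles through a point -/

section RectanglesAt

variable {K : Type*} {k : ℕ} {R : Fin k → Set K}

open Classical in
/-- The set of (indices of) rectangles containing the point `x`. -/
noncomputable def rectanglesAt (R : Fin k → Set K) (x : K) : Finset (Fin k) := {i | x ∈ R i}

theorem mem_rectanglesAt {x : K} {i : Fin k} : i ∈ rectanglesAt R x ↔ x ∈ R i := by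
  simp [rectanglesAt]

theorem mem_intersectingSets {q : ℕ} {s : Finset (Fin k)} :
    s ∈ intersectingSets R q ↔ s.card = q ∧ (⋂ i ∈ s, R i).Nonempty := by
  simp [intersectingSets]

theorem mem_intersectingSets_of_subset {x : K} {q : ℕ} {s : Finset (Fin k)} (hs : s.card = q)
    (h : s ⊆ rectanglesAt R x) : s ∈ intersectingSets R q :=
  mem_intersectingSets.mpr
    ⟨hs, x, Set.mem_iInter₂.mpr fun _ hi => mem_rectanglesAt.mp (h hi)⟩

theorem intersectingSets_nonempty_of_le {q n : ℕ} (h : q ≤ n)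
    (hn : (intersectingSets R n).Nonempty) : (intersectingSets R q).Nonempty := by
  obtain ⟨s, hs⟩ := hn
  obtain ⟨hcard, z, hz⟩ := mem_intersectingSets.mp hs
  obtain ⟨t, hts, ht⟩ := Finset.exists_subset_card_eq (h.trans_eq hcard.symm)
  rw [Set.mem_iInter₂] at hz
  exact ⟨t, mem_intersectingSets.mpr ⟨ht, z, Set.mem_iInter₂.mpr fun i hi => hz i (hts hi)⟩⟩

end RectanglesAt

/-! ### Combinatorics of a Markov partition -/

section Markov

variable {K : Type*} [MetricSpace K] {f : K → K} {r lam c ε : ℝ} {k : ℕ} {R : Fin k → Set K}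

theorem transitionMatrix_eq_one_iff {a b : Fin k} : transitionMatrix f R a b = 1 ↔
    (f '' interior (R a) ∩ interior (R b)).Nonempty := by
  unfold transitionMatrix
  split_ifs with h <;> simp [h]

theorem transitionMatrix_eq_zero_of_ne_one {a b : Fin k} (h : transitionMatrix f R a b ≠ 1) :
    transitionMatrix f R a b = 0 := by
  rw [Ne, transitionMatrix_eq_one_iff] at h
  simp [transitionMatrix, h]

theorem IsMarkovPartition.isClosed (hR : IsMarkovPartition f ε c R) (i : Fin k) :
    IsClosed (R i) := by
  rw [hR.proper i]
  exact isClosed_closure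

theorem IsMarkovPartition.dist_lt [CompactSpace K] (hR : IsMarkovPartition f ε c R) {i : Fin k}
    {x y : K} (hx : x ∈ R i) (hy : y ∈ R i) : dist x y < min ε (c / 2) :=
  (Metric.dist_le_diam_of_mem (hR.isClosed i).isCompact.isBounded hx hy).trans_lt (hR.diam_lt i)

/-- The map is injective on the union of two rectangles with a common point. -/
theorem IsMarkovPartition.eq_of_map_eq [CompactSpace K] (hf : IsRuelleExpandingWith r lam c f)
    (hR : IsMarkovPartition f ε c R) {a b : Fin k} {x y z : K} (hx : x ∈ R a) (hy : y ∈ R b)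
    (hza : z ∈ R a) (hzb : z ∈ R b) (hxy : f x = f y) : x = y := by
  refine hf.eq_of_dist_le hxy ?_
  have h1 := (hR.dist_lt hx hza).trans_le (min_le_right _ _)
  have h2 := (hR.dist_lt hzb hy).trans_le (min_le_right _ _)
  linarith [dist_triangle x z y]

/-- Among rectangles with a common point, at most one can be followed by a given rectangle. -/
theorem IsMarkovPartition.eq_of_transition [CompactSpace K]
    (hf : IsRuelleExpandingWith r lam c f) (hR : IsMarkovPartition f ε c R) {a a' b : Fin k}
    {z : K} (hza : z ∈ R a) (hza' : z ∈ R a') (ha : transitionMatrix f R a b = 1)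
    (ha' : transitionMatrix f R a' b = 1) : a = a' := by
  rw [transitionMatrix_eq_one_iff] at ha ha'
  obtain ⟨y, -, hy⟩ := id ha
  obtain ⟨u, hu, huy⟩ := hR.markov a b ha hy
  obtain ⟨v, hv, hvy⟩ := hR.markov a' b ha' hy
  have huv : u = v := hR.eq_of_map_eq hf (interior_subset hu) (interior_subset hv) hza hza'
    (huy.trans hvy.symm)
  by_contra hne
  have hmem : u ∈ interior (R a) ∩ interior (R a') := ⟨hu, huv ▸ hv⟩
  rw [hR.disjoint a a' hne] at hmem
  exact hmem

theorem IsMarkovPartition.subset_image [CompactSpace K] (hf : IsRuelleExpandingWith r lam c f)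
    (hR : IsMarkovPartition f ε c R) {a b : Fin k} (h : transitionMatrix f R a b = 1) :
    R b ⊆ f '' R a := by
  rw [hR.proper b]
  refine closure_minimal ?_ ((hR.isClosed a).isCompact.image hf.continuous).isClosed
  exact (hR.markov a b (transitionMatrix_eq_one_iff.mp h)).trans
    (Set.image_mono interior_subset)

/-- If `f x ∈ R b`, then some rectangle containing `x` can be followed by `R b`. -/
theorem IsMarkovPartition.exists_predecessor (hf : IsRuelleExpandingWith r lam c f)
    (hR : IsMarkovPartition f ε c R) {x : K} {b : Fin k} (hb : f x ∈ R b) :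
    ∃ a, x ∈ R a ∧ transitionMatrix f R a b = 1 := by
  have hx : x ∈ closure (f ⁻¹' interior (R b)) := by
    rw [← hf.isOpenMap.preimage_closure_eq_closure_preimage hf.continuous, ← hR.proper b]
    exact hb
  have hcov : f ⁻¹' interior (R b) = ⋃ a, f ⁻¹' interior (R b) ∩ R a := by
    rw [← Set.inter_iUnion, hR.cover, Set.inter_univ]
  rw [hcov, closure_iUnion_of_finite, Set.mem_iUnion] at hx
  obtain ⟨a, ha⟩ := hx
  refine ⟨a, (closure_minimal Set.inter_subset_right (hR.isClosed a)) ha, ?_⟩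
  obtain ⟨u, hu, hua⟩ := closure_nonempty_iff.mp ⟨x, ha⟩
  rw [hR.proper a] at hua
  obtain ⟨v, hvb, hva⟩ := mem_closure_iff.mp hua _
    (isOpen_interior.preimage hf.continuous) hu
  exact transitionMatrix_eq_one_iff.mpr ⟨f v, ⟨v, hva, rfl⟩, hvb⟩

/-- Common points of rectangles pull back along a system of transitions. -/
theorem IsMarkovPartition.exists_pullback [CompactSpace K]
    (hf : IsRuelleExpandingWith r lam c f) (hR : IsMarkovPartition f ε c R)
    {s t : Finset (Fin k)} (hs : s.Nonempty) (hsR : (⋂ i ∈ s, R i).Nonempty)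
    (hst : ∀ a ∈ s, ∃ b ∈ t, transitionMatrix f R a b = 1) {y : K} (hy : ∀ b ∈ t, y ∈ R b) :
    ∃ x, f x = y ∧ ∀ a ∈ s, x ∈ R a := by
  obtain ⟨z, hz⟩ := hsR
  rw [Set.mem_iInter₂] at hz
  have hpre : ∀ a ∈ s, ∃ x ∈ R a, f x = y := by
    intro a ha
    obtain ⟨b, hb, hab⟩ := hst a ha
    exact hR.subset_image hf hab (hy b hb)
  obtain ⟨a₀, ha₀⟩ := hs
  obtain ⟨x, hx, hxy⟩ := hpre a₀ ha₀
  refine ⟨x, hxy, fun a ha => ?_⟩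
  obtain ⟨x', hx', hxy'⟩ := hpre a ha
  rwa [hR.eq_of_map_eq hf hx hx' (hz a₀ ha₀) (hz a ha) (hxy.trans hxy'.symm)]

theorem IsMarkovPartition.eq_of_itinerary [CompactSpace K] (hε : IsExpansiveConstant f ε)
    (hR : IsMarkovPartition f ε c R) {x y : K}
    (h : ∀ n, ∃ a, f^[n] x ∈ R a ∧ f^[n] y ∈ R a) : x = y := by
  refine hε x y fun n => ?_
  obtain ⟨a, hx, hy⟩ := h n
  exact ((hR.dist_lt hx hy).trans_le (min_le_left _ _)).le

/-- Every itinerary of sets of rectangles with common points, compatible with the transitions, is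
realized by a point. -/
theorem IsMarkovPartition.exists_of_itinerary [CompactSpace K]
    (hf : IsRuelleExpandingWith r lam c f) (hR : IsMarkovPartition f ε c R)
    (W : ℕ → Finset (Fin k)) (hne : ∀ n, (W n).Nonempty) (hW : ∀ n, (⋂ i ∈ W n, R i).Nonempty)
    (hA : ∀ n, ∀ a ∈ W n, ∃ b ∈ W (n + 1), transitionMatrix f R a b = 1) :
    ∃ x, ∀ n, ∀ a ∈ W n, f^[n] x ∈ R a := by
  have hfin : ∀ (n : ℕ) (W : ℕ → Finset (Fin k)), (∀ n, (W n).Nonempty) →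
      (∀ n, (⋂ i ∈ W n, R i).Nonempty) →
      (∀ n, ∀ a ∈ W n, ∃ b ∈ W (n + 1), transitionMatrix f R a b = 1) →
      ∃ x, ∀ m ≤ n, ∀ a ∈ W m, f^[m] x ∈ R a := by
    intro n
    induction n with
    | zero =>
      intro W _ hW _
      obtain ⟨x, hx⟩ := hW 0
      rw [Set.mem_iInter₂] at hx
      exact ⟨x, fun m hm => by obtain rfl := Nat.le_zero.mp hm; exact hx⟩
    | succ n ih =>
      intro W hne hW hA
      obtain ⟨y, hy⟩ := ih (fun m => W (m + 1)) (fun m => hne _) (fun m => hW _) fun m => hA _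
      obtain ⟨x, hxy, hx⟩ := hR.exists_pullback hf (hne 0) (hW 0) (hA 0) (hy 0 (Nat.zero_le n))
      refine ⟨x, fun m hm => ?_⟩
      cases m with
      | zero => exact hx
      | succ m =>
        rw [Function.iterate_succ_apply, hxy]
        exact hy m (Nat.le_of_succ_le_succ hm)
  let C : ℕ → Set K := fun n => ⋂ m ≤ n, ⋂ a ∈ W m, f^[m] ⁻¹' R a
  have hC : ∀ n x, x ∈ C n ↔ ∀ m ≤ n, ∀ a ∈ W m, f^[m] x ∈ R a := by
    intro n x
    simp [C]
  have hclosed : ∀ n, IsClosed (C n) := fun n =>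
    isClosed_iInter fun m => isClosed_iInter fun _ => isClosed_iInter fun a =>
      isClosed_iInter fun _ => (hR.isClosed a).preimage (hf.continuous.iterate m)
  obtain ⟨x, hx⟩ := IsCompact.nonempty_iInter_of_sequence_nonempty_isCompact_isClosed C
    (fun n x hx => (hC n x).mpr fun m hm => (hC _ x).mp hx m (Nat.le_succ_of_le hm))
    (fun n => by
      obtain ⟨x, hx⟩ := hfin n W hne hW hA
      exact ⟨x, (hC n x).mpr hx⟩)
    (hclosed 0).isCompact hclosed
  rw [Set.mem_iInter] at hx
  exact ⟨x, fun n => (hC n x).mp (hx n) n le_rfl⟩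

theorem IsMarkovPartition.rectanglesAt_nonempty (hR : IsMarkovPartition f ε c R) (x : K) :
    (rectanglesAt R x).Nonempty := by
  obtain ⟨i, hi⟩ := Set.mem_iUnion.mp (hR.cover.symm ▸ Set.mem_univ x : x ∈ ⋃ i, R i)
  exact ⟨i, mem_rectanglesAt.mpr hi⟩

/-- A periodic point is determined by the rectangles which its orbit visits, so there are finitely
many of a given period. -/
theorem IsMarkovPartition.finite_ptsOfPeriod [CompactSpace K] (hε : IsExpansiveConstant f ε)
    (hR : IsMarkovPartition f ε c R) {p : ℕ} (hp : 1 ≤ p) : (Function.ptsOfPeriod f p).Finite := by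
  refine Set.Finite.of_injOn (f := fun x (i : Fin p) => rectanglesAt R (f^[i] x))
    (t := Set.univ) (fun _ _ => Set.mem_univ _) ?_ Set.finite_univ
  intro x hx y hy hxy
  refine hR.eq_of_itinerary hε fun n => ?_
  obtain ⟨a, ha⟩ := hR.rectanglesAt_nonempty (f^[n] x)
  refine ⟨a, mem_rectanglesAt.mp ha, ?_⟩
  have h := congrFun hxy ⟨n % p, Nat.mod_lt _ hp⟩
  simp only at h
  rw [Function.IsPeriodicPt.iterate_mod_apply hx, Function.IsPeriodicPt.iterate_mod_apply hy] at h
  rw [h] at ha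
  exact mem_rectanglesAt.mp ha

end Markov

/-! ### Signed transition matrices as compound matrices -/

section Signed

variable {K : Type*} [MetricSpace K] {f : K → K} {r lam c ε : ℝ} {k : ℕ} {R : Fin k → Set K}

open Classical in
/-- The signed transition matrix, extended by zero to all `q`-element sets of indices: its entries
are the minors of the transition matrix on sets of rectangles with a common point. -/
noncomputable def signedMinorMatrix (f : K → K) (R : Fin k → Set K) (q : ℕ) :
    Matrix (Set.powersetCard (Fin k) q) (Set.powersetCard (Fin k) q) ℤ :=
  fun s t => if s.1 ∈ intersectingSets R q ∧ t.1 ∈ intersectingSets R q then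
    (transitionMatrix f R).compound q s t else 0

theorem transition_of_prod_ne_zero {ι : Type*} [Fintype ι] {g h : ι → Fin k}
    (hprod : ∏ i, transitionMatrix f R (g i) (h i) ≠ 0) (i : ι) :
    transitionMatrix f R (g i) (h i) = 1 := by
  by_contra hne
  exact hprod (Finset.prod_eq_zero (Finset.mem_univ i) (transitionMatrix_eq_zero_of_ne_one hne))

/-- A nonzero minor of the transition matrix exhibits a matching by transitions. -/
theorem exists_transition_of_compound_ne_zero {q : ℕ} {s t : Set.powersetCard (Fin k) q}
    (h : (transitionMatrix f R).compound q s t ≠ 0) :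
    ∀ a ∈ s.1, ∃ b ∈ t.1, transitionMatrix f R a b = 1 := by
  rw [Matrix.compound, ← Matrix.det_transpose, Matrix.det_apply'] at h
  obtain ⟨μ, -, hμ⟩ := Finset.exists_ne_zero_of_sum_ne_zero h
  have hμ' := transition_of_prod_ne_zero (f := f) (R := R)
    (g := s.1.orderEmbOfFin (Set.powersetCard.card_eq s))
    (h := fun i => t.1.orderEmbOfFin (Set.powersetCard.card_eq t) (μ i))
    (right_ne_zero_of_mul hμ)
  intro a ha
  obtain ⟨i, rfl⟩ : a ∈ Set.range (s.1.orderEmbOfFin (Set.powersetCard.card_eq s)) := by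
    rw [Finset.range_orderEmbOfFin]
    exact ha
  exact ⟨_, Finset.orderEmbOfFin_mem _ _ _, hμ' i⟩

/-- Rectangles of `s ∈ I_q` have a common point, so at most one of them can be followed by a given
rectangle. Hence at most one permutation contributes to the corresponding minor of the transition
matrix. -/
theorem IsMarkovPartition.signedTransitionMatrix_eq_compound [CompactSpace K]
    (hf : IsRuelleExpandingWith r lam c f) (hR : IsMarkovPartition f ε c R) {q : ℕ}
    (s t : intersectingSets R q) :
    signedTransitionMatrix f R q s t = (transitionMatrix f R).compound q
      ⟨s.1, card_of_mem_intersectingSets s.2⟩ ⟨t.1, card_of_mem_intersectingSets t.2⟩ := by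
  classical
  have hcompound : (transitionMatrix f R).compound q ⟨s.1, card_of_mem_intersectingSets s.2⟩
      ⟨t.1, card_of_mem_intersectingSets t.2⟩ = ∑ μ : Equiv.Perm (Fin q),
        ((Equiv.Perm.sign μ : ℤˣ) : ℤ) *
          ∏ i, transitionMatrix f R (enumSet s i) (enumSet t (μ i)) := by
    rw [Matrix.compound, ← Matrix.det_transpose, Matrix.det_apply']
    rfl
  obtain ⟨z, hz⟩ := (mem_intersectingSets.mp s.2).2
  rw [Set.mem_iInter₂] at hz
  have hz' : ∀ i, z ∈ R (enumSet s i) := fun i => hz _ (Finset.orderEmbOfFin_mem _ _ _)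
  have huniq : ∀ μ ν : Equiv.Perm (Fin q),
      (∀ i, transitionMatrix f R (enumSet s i) (enumSet t (μ i)) = 1) →
      (∀ i, transitionMatrix f R (enumSet s i) (enumSet t (ν i)) = 1) → μ = ν := by
    intro μ ν hμ hν
    rw [← inv_inj]
    ext1 j
    have h1 := hμ (μ⁻¹ j)
    have h2 := hν (ν⁻¹ j)
    rw [← Equiv.Perm.mul_apply, mul_inv_cancel, Equiv.Perm.one_apply] at h1 h2
    exact (s.1.orderEmbOfFin _).injective (hR.eq_of_transition hf (hz' _) (hz' _) h1 h2)
  rw [hcompound]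
  unfold signedTransitionMatrix
  split_ifs with h
  · rw [Finset.sum_eq_single h.choose]
    · rw [Finset.prod_eq_one fun i _ => h.choose_spec.1 i, mul_one]
    · intro μ _ hne
      by_contra hμ
      exact hne (huniq _ _ (transition_of_prod_ne_zero (right_ne_zero_of_mul hμ))
        h.choose_spec.1)
    · exact fun hmem => absurd (Finset.mem_univ _) hmem
  · symm
    refine Finset.sum_eq_zero fun μ _ => ?_
    by_contra hμ
    have hμ' := transition_of_prod_ne_zero (right_ne_zero_of_mul hμ)
    exact h ⟨μ, hμ', fun ν hν => huniq _ _ hν hμ'⟩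

theorem IsMarkovPartition.trace_signedTransitionMatrix_pow [CompactSpace K]
    (hf : IsRuelleExpandingWith r lam c f) (hR : IsMarkovPartition f ε c R) (q : ℕ) {p : ℕ}
    (hp : p ≠ 0) :
    (signedTransitionMatrix f R q ^ p).trace = (signedMinorMatrix f R q ^ p).trace := by
  let e : intersectingSets R q ↪ Set.powersetCard (Fin k) q :=
    ⟨fun s => ⟨s.1, card_of_mem_intersectingSets s.2⟩,
      fun s t h => Subtype.ext (congrArg (fun u => u.1) h)⟩
  rw [← Matrix.trace_submatrix_pow (signedMinorMatrix f R q) e _ hp]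
  · congr 2
    ext s t
    rw [hR.signedTransitionMatrix_eq_compound hf]
    exact (if_pos ⟨s.2, t.2⟩).symm
  · intro s t hs
    exact if_neg fun h => hs ⟨⟨s.1, h.1⟩, rfl⟩

end Signed

/-! ### The transitions along an orbit -/

section Local

variable {K : Type*} [MetricSpace K] {f : K → K} {r lam c ε : ℝ} {k : ℕ} {R : Fin k → Set K}

/-- The transition matrix from the rectangles containing `x` to those containing `f x`; all its
other entries are zero. -/
noncomputable def localTransitionMatrix (f : K → K) (R : Fin k → Set K) (x : K) :
    Matrix (Fin k) (Fin k) ℤ :=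
  fun a b => if a ∈ rectanglesAt R x ∧ b ∈ rectanglesAt R (f x) then
    transitionMatrix f R a b else 0

theorem compound_localTransitionMatrix {q : ℕ} (s t : Set.powersetCard (Fin k) q) (x : K) :
    (localTransitionMatrix f R x).compound q s t =
      if s.1 ⊆ rectanglesAt R x ∧ t.1 ⊆ rectanglesAt R (f x) then
        (transitionMatrix f R).compound q s t else 0 := by
  split_ifs with h
  · unfold Matrix.compound
    congr 1
    ext i j
    exact if_pos ⟨h.1 (Finset.orderEmbOfFin_mem _ _ _), h.2 (Finset.orderEmbOfFin_mem _ _ _)⟩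
  · rw [not_and_or, Finset.not_subset, Finset.not_subset] at h
    rcases h with ⟨a, ha, hna⟩ | ⟨b, hb, hnb⟩
    · obtain ⟨i, rfl⟩ : a ∈ Set.range (s.1.orderEmbOfFin (Set.powersetCard.card_eq s)) := by
        rwa [Finset.range_orderEmbOfFin s.1 (Set.powersetCard.card_eq s)]
      exact Matrix.det_eq_zero_of_row_eq_zero i fun j => if_neg fun h => hna h.1
    · obtain ⟨j, rfl⟩ : b ∈ Set.range (t.1.orderEmbOfFin (Set.powersetCard.card_eq t)) := by
        rwa [Finset.range_orderEmbOfFin t.1 (Set.powersetCard.card_eq t)]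
      exact Matrix.det_eq_zero_of_column_eq_zero j fun i => if_neg fun h => hnb h.2

/-- Every rectangle containing `f x` has exactly one predecessor among those containing `x`. -/
theorem IsMarkovPartition.vecMul_localTransitionMatrix [CompactSpace K]
    (hf : IsRuelleExpandingWith r lam c f) (hR : IsMarkovPartition f ε c R) (x : K) :
    Matrix.vecMul (fun a => if a ∈ rectanglesAt R x then 1 else 0) (localTransitionMatrix f R x) =
      fun b => if b ∈ rectanglesAt R (f x) then 1 else 0 := by
  ext b
  simp only [Matrix.vecMul, dotProduct, ite_mul, one_mul, zero_mul]
  split_ifs with hb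
  · obtain ⟨a, ha, hab⟩ := hR.exists_predecessor hf (mem_rectanglesAt.mp hb)
    rw [Finset.sum_eq_single a]
    · rw [if_pos (mem_rectanglesAt.mpr ha), localTransitionMatrix,
        if_pos ⟨mem_rectanglesAt.mpr ha, hb⟩, hab]
    · intro a' _ hne
      by_contra h
      have ha' : a' ∈ rectanglesAt R x := by
        by_contra hn
        exact h (if_neg hn)
      rw [if_pos ha', localTransitionMatrix, if_pos ⟨ha', hb⟩] at h
      have h1 : transitionMatrix f R a' b = 1 := by
        by_contra hn
        exact h (transitionMatrix_eq_zero_of_ne_one hn)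
      exact hne (hR.eq_of_transition hf (mem_rectanglesAt.mp ha') ha h1 hab)
    · exact fun hmem => absurd (Finset.mem_univ _) hmem
  · refine Finset.sum_eq_zero fun a _ => ?_
    have h0 : localTransitionMatrix f R x a b = 0 := if_neg fun h => hb h.2
    rw [h0, ite_self]

theorem IsMarkovPartition.vecMul_list_prod_localTransitionMatrix [CompactSpace K]
    (hf : IsRuelleExpandingWith r lam c f) (hR : IsMarkovPartition f ε c R) (x : K) (n : ℕ) :
    Matrix.vecMul (fun a => if a ∈ rectanglesAt R x then 1 else 0)
        ((List.range n).map fun m => localTransitionMatrix f R (f^[m] x)).prod =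
      fun b => if b ∈ rectanglesAt R (f^[n] x) then 1 else 0 := by
  induction n with
  | zero => exact Matrix.vecMul_one _
  | succ n ih =>
    rw [List.range_succ, List.map_append, List.prod_append, ← Matrix.vecMul_vecMul, ih,
      List.map_singleton, List.prod_singleton, hR.vecMul_localTransitionMatrix hf,
      Function.iterate_succ_apply']

/-- Each periodic point contributes exactly `1` to the alternating sum of traces. -/
theorem IsMarkovPartition.sum_trace_compound_localTransitionMatrix [CompactSpace K]
    (hf : IsRuelleExpandingWith r lam c f) (hR : IsMarkovPartition f ε c R) {x : K} {p : ℕ}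
    (hx : f^[p] x = x) :
    ∑ q ∈ Finset.Icc 1 k, (-1 : ℤ) ^ (q - 1) * ((List.range p).map fun m =>
      (localTransitionMatrix f R (f^[m] x)).compound q).prod.trace = 1 := by
  have hfix := hR.vecMul_list_prod_localTransitionMatrix hf x p
  rw [hx] at hfix
  have hne : (fun a => if a ∈ rectanglesAt R x then (1 : ℤ) else 0) ≠ 0 := by
    obtain ⟨a, ha⟩ := hR.rectanglesAt_nonempty x
    intro h
    simpa [ha] using congrFun h a
  have h := Matrix.sum_trace_compound_eq_one _ hne hfix
  simpa only [Fintype.card_fin, Matrix.compound_list_prod, List.map_map, Function.comp_def] using h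

end Local

/-! ### Closed paths of sets of rectangles and periodic points -/

section ClosedPaths

variable {K : Type*} [MetricSpace K] {f : K → K} {r lam c ε : ℝ} {k : ℕ} {R : Fin k → Set K}

/-- A closed path of sets of rectangles with nonzero weight is carried by exactly one periodic
point. -/
theorem IsMarkovPartition.existsUnique_of_closedPath [CompactSpace K]
    (hf : IsRuelleExpandingWith r lam c f) (hε : IsExpansiveConstant f ε)
    (hR : IsMarkovPartition f ε c R) {q p : ℕ} (hq : 1 ≤ q) (hp : 1 ≤ p)
    (w : Fin (p + 1) → Set.powersetCard (Fin k) q) (hw : w 0 = w (Fin.last p))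
    (hI : ∀ i, (w i).1 ∈ intersectingSets R q)
    (hA : ∀ m : Fin p, (transitionMatrix f R).compound q (w m.castSucc) (w m.succ) ≠ 0) :
    ∃! x, f^[p] x = x ∧ ∀ i : Fin (p + 1), (w i).1 ⊆ rectanglesAt R (f^[(i : ℕ)] x) := by
  -- the path is continued periodically to all times
  let W : ℕ → Finset (Fin k) := fun n => (w ⟨n % p, (Nat.mod_lt n hp).trans p.lt_succ_self⟩).1
  have hWsucc : ∀ n, W (n + 1) = (w (Fin.succ ⟨n % p, Nat.mod_lt n hp⟩)).1 := by
    intro n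
    have hlt := Nat.mod_lt n hp
    have hmod : (n + 1) % p = (n % p + 1) % p := by rw [Nat.mod_add_mod]
    rcases Nat.lt_or_ge (n % p + 1) p with h | h
    · simp only [W, Fin.succ_mk, hmod, Nat.mod_eq_of_lt h]
    · -- at the end of a period the path has index `p`, and the continuation index `0`
      have hlast : Fin.succ ⟨n % p, hlt⟩ = Fin.last p := Fin.ext (by simp; omega)
      have hzero : (n + 1) % p = 0 := by rw [hmod, show n % p + 1 = p by omega, Nat.mod_self]
      rw [hlast, ← hw]
      simp only [W, hzero]
      rfl
  have hWp : ∀ n, W (p + n) = W n := fun n => by simp only [W, Nat.add_mod_left]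
  have hWne : ∀ n, (W n).Nonempty := fun n => by
    rw [← Finset.card_pos]
    exact hq.trans_eq (w _).2.symm
  obtain ⟨x, hx⟩ := hR.exists_of_itinerary hf W hWne (fun n => (mem_intersectingSets.mp (hI _)).2)
    fun n => by
      rw [hWsucc]
      exact exists_transition_of_compound_ne_zero (hA ⟨n % p, Nat.mod_lt n hp⟩)
  have huniq : ∀ y z, (∀ n, ∀ a ∈ W n, f^[n] y ∈ R a) → (∀ n, ∀ a ∈ W n, f^[n] z ∈ R a) →
      y = z := fun y z hy hz => hR.eq_of_itinerary hε fun n => by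
    obtain ⟨a, ha⟩ := hWne n
    exact ⟨a, hy n a ha, hz n a ha⟩
  have hwW : ∀ i : Fin (p + 1), (w i).1 = W i := by
    intro i
    rcases Nat.lt_or_ge i p with hlt | hge
    · simp only [W, Nat.mod_eq_of_lt hlt]
    · have hi : i = Fin.last p := Fin.ext (by simp; omega)
      subst hi
      rw [← hw]
      simp only [W, Fin.val_last, Nat.mod_self]
      rfl
  refine ⟨x, ⟨huniq _ _ (fun n a ha => ?_) hx, fun i a ha => ?_⟩, fun y hy => ?_⟩
  · rw [← Function.iterate_add_apply, add_comm]
    exact hx _ a ((hWp n).symm ▸ ha)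
  · rw [hwW] at ha
    exact mem_rectanglesAt.mpr (hx _ a ha)
  · refine huniq _ _ (fun n a ha => ?_) hx
    have h := mem_rectanglesAt.mp (hy.2 ⟨n % p, (Nat.mod_lt n hp).trans p.lt_succ_self⟩ ha)
    rwa [Function.IsPeriodicPt.iterate_mod_apply hy.1] at h

theorem subset_rectanglesAt_of_prod_ne_zero {q p : ℕ} (hp : 1 ≤ p)
    {w : Fin (p + 1) → Set.powersetCard (Fin k) q} {x : K}
    (h : ∏ m : Fin p, (localTransitionMatrix f R (f^[(m : ℕ)] x)).compound q
      (w m.castSucc) (w m.succ) ≠ 0) :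
    (∀ i : Fin (p + 1), (w i).1 ⊆ rectanglesAt R (f^[(i : ℕ)] x)) ∧
      ∀ m : Fin p, (transitionMatrix f R).compound q (w m.castSucc) (w m.succ) ≠ 0 := by
  rw [Finset.prod_ne_zero_iff] at h
  simp only [compound_localTransitionMatrix, ite_ne_right_iff, Finset.mem_univ,
    forall_const] at h
  refine ⟨fun i => ?_, fun m => (h m).2⟩
  cases i using Fin.cases with
  | zero => exact (h ⟨0, hp⟩).1.1
  | succ m =>
    rw [Fin.val_succ, Function.iterate_succ_apply']
    exact (h m).1.2

theorem mem_intersectingSets_of_prod_ne_zero {q p : ℕ} (hp : 1 ≤ p)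
    {w : Fin (p + 1) → Set.powersetCard (Fin k) q}
    (h : ∏ m : Fin p, signedMinorMatrix f R q (w m.castSucc) (w m.succ) ≠ 0) :
    (∀ i : Fin (p + 1), (w i).1 ∈ intersectingSets R q) ∧
      ∀ m : Fin p, (transitionMatrix f R).compound q (w m.castSucc) (w m.succ) ≠ 0 := by
  rw [Finset.prod_ne_zero_iff] at h
  simp only [signedMinorMatrix, ite_ne_right_iff, Finset.mem_univ, forall_const] at h
  refine ⟨fun i => ?_, fun m => (h m).2⟩
  cases i using Fin.cases with
  | zero => exact (h ⟨0, hp⟩).1.1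
  | succ m => exact (h m).1.2

/-- The weight of a closed path in the trace of a power of the signed transition matrix is
distributed over the periodic points which carry the path. -/
theorem IsMarkovPartition.prod_signedMinorMatrix_eq_sum [CompactSpace K]
    (hf : IsRuelleExpandingWith r lam c f) (hε : IsExpansiveConstant f ε)
    (hR : IsMarkovPartition f ε c R) {q p : ℕ} (hq : 1 ≤ q) (hp : 1 ≤ p)
    (hfin : (Function.ptsOfPeriod f p).Finite)
    (w : Fin (p + 1) → Set.powersetCard (Fin k) q) (hw : w 0 = w (Fin.last p)) :
    ∏ m : Fin p, signedMinorMatrix f R q (w m.castSucc) (w m.succ) =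
      ∑ x ∈ hfin.toFinset, ∏ m : Fin p,
        (localTransitionMatrix f R (f^[(m : ℕ)] x)).compound q (w m.castSucc) (w m.succ) := by
  by_cases hpath : (∀ i, (w i).1 ∈ intersectingSets R q) ∧
      ∀ m : Fin p, (transitionMatrix f R).compound q (w m.castSucc) (w m.succ) ≠ 0
  · obtain ⟨x, ⟨hx, hwx⟩, huniq⟩ :=
      hR.existsUnique_of_closedPath hf hε hq hp w hw hpath.1 hpath.2
    rw [Finset.sum_eq_single x]
    · refine Finset.prod_congr rfl fun m _ => ?_
      have hsucc := hwx m.succ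
      rw [Fin.val_succ, Function.iterate_succ_apply'] at hsucc
      rw [compound_localTransitionMatrix, if_pos ⟨hwx m.castSucc, hsucc⟩, signedMinorMatrix,
        if_pos ⟨hpath.1 _, hpath.1 _⟩]
    · intro y hy hne
      by_contra h
      exact hne (huniq y ⟨(Set.Finite.mem_toFinset hfin).mp hy,
        (subset_rectanglesAt_of_prod_ne_zero hp h).1⟩)
    · exact fun h => absurd ((Set.Finite.mem_toFinset hfin).mpr hx) h
  · rw [Finset.sum_eq_zero]
    · by_contra h
      exact hpath (mem_intersectingSets_of_prod_ne_zero hp h)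
    · intro x _
      by_contra h
      obtain ⟨h1, h2⟩ := subset_rectanglesAt_of_prod_ne_zero hp h
      exact hpath ⟨fun i => mem_intersectingSets_of_subset
        (Set.powersetCard.card_eq (w i)) (h1 i), h2⟩

theorem IsMarkovPartition.trace_signedTransitionMatrix_pow_eq_sum [CompactSpace K]
    (hf : IsRuelleExpandingWith r lam c f) (hε : IsExpansiveConstant f ε)
    (hR : IsMarkovPartition f ε c R) {q p : ℕ} (hq : 1 ≤ q) (hp : 1 ≤ p)
    (hfin : (Function.ptsOfPeriod f p).Finite) :
    (signedTransitionMatrix f R q ^ p).trace = ∑ x ∈ hfin.toFinset, ((List.range p).map fun m =>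
      (localTransitionMatrix f R (f^[m] x)).compound q).prod.trace := by
  have hpow : signedMinorMatrix f R q ^ p =
      ((List.range p).map fun _ => signedMinorMatrix f R q).prod := by simp
  rw [hR.trace_signedTransitionMatrix_pow hf q (Nat.one_le_iff_ne_zero.mp hp), hpow,
    Matrix.trace_list_prod_eq_sum_paths]
  simp only [Matrix.trace_list_prod_eq_sum_paths]
  rw [Finset.sum_comm]
  refine Finset.sum_congr rfl fun w _ => ?_
  by_cases hw : w 0 = w (Fin.last p)
  · simp only [if_pos hw]
    exact hR.prod_signedMinorMatrix_eq_sum hf hε hq hp hfin w hw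
  · simp only [if_neg hw, Finset.sum_const_zero]

/-- The formula for the number of periodic points, with all orders up to the number of
rectangles. -/
theorem IsMarkovPartition.ncard_ptsOfPeriod [CompactSpace K]
    (hf : IsRuelleExpandingWith r lam c f) (hε : IsExpansiveConstant f ε)
    (hR : IsMarkovPartition f ε c R) {p : ℕ} (hp : 1 ≤ p) :
    ((Function.ptsOfPeriod f p).ncard : ℤ) = ∑ q ∈ Finset.Icc 1 k,
      (-1 : ℤ) ^ (q - 1) * Matrix.trace (signedTransitionMatrix f R q ^ p) := by
  have hfin := hR.finite_ptsOfPeriod hε hp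
  calc ((Function.ptsOfPeriod f p).ncard : ℤ) = ∑ x ∈ hfin.toFinset, 1 := by
        rw [Set.ncard_eq_toFinset_card _ hfin, Finset.sum_const, nsmul_one]
    _ = ∑ x ∈ hfin.toFinset, ∑ q ∈ Finset.Icc 1 k, (-1 : ℤ) ^ (q - 1) *
          ((List.range p).map fun m =>
            (localTransitionMatrix f R (f^[m] x)).compound q).prod.trace :=
        Finset.sum_congr rfl fun x hx => (hR.sum_trace_compound_localTransitionMatrix hf
          ((Set.Finite.mem_toFinset hfin).mp hx)).symm
    _ = _ := by
        rw [Finset.sum_comm]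
        refine Finset.sum_congr rfl fun q hq => ?_
        rw [hR.trace_signedTransitionMatrix_pow_eq_sum hf hε (Finset.mem_Icc.mp hq).1 hp hfin,
          Finset.mul_sum]

end ClosedPaths

theorem mainTheorem2 {K : Type*} [MetricSpace K] [CompactSpace K] [Nonempty K]
    (f : K → K) (r lam c : ℝ) (hf : IsRuelleExpandingWith r lam c f)
    (ε : ℝ) (hε : IsExpansiveConstant f ε)
    {k : ℕ} (R : Fin k → Set K) (hR : IsMarkovPartition f ε c R) :
    ∃ L : ℕ,
      IsGreatest {q : ℕ | q ∈ Finset.Icc 1 k ∧ (intersectingSets R q).Nonempty} L ∧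
      (∀ q ∈ Finset.Icc 1 L, (intersectingSets R q).Nonempty) ∧
      ∀ p : ℕ, 1 ≤ p →
        (Function.ptsOfPeriod f p).Finite ∧
        ((Function.ptsOfPeriod f p).ncard : ℤ) =
          ∑ q ∈ Finset.Icc 1 L,
            (-1 : ℤ) ^ (q - 1) * Matrix.trace (signedTransitionMatrix f R q ^ p) := by
  have hex : {q : ℕ | q ∈ Finset.Icc 1 k ∧ (intersectingSets R q).Nonempty}.Nonempty := by
    obtain ⟨x⟩ := ‹Nonempty K›
    obtain ⟨i, hi⟩ := hR.rectanglesAt_nonempty x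
    exact ⟨1, Finset.mem_Icc.mpr ⟨le_rfl, i.pos⟩, {i},
      mem_intersectingSets_of_subset (Finset.card_singleton i)
        (Finset.singleton_subset_iff.mpr hi)⟩
  have hbdd : BddAbove {q : ℕ | q ∈ Finset.Icc 1 k ∧ (intersectingSets R q).Nonempty} :=
    ⟨k, fun q hq => (Finset.mem_Icc.mp hq.1).2⟩
  obtain ⟨L, hL⟩ : ∃ L, IsGreatest
      {q : ℕ | q ∈ Finset.Icc 1 k ∧ (intersectingSets R q).Nonempty} L :=
    ⟨_, Nat.sSup_mem hex hbdd, fun _ hq => le_csSup hbdd hq⟩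
  refine ⟨L, hL, fun q hq => intersectingSets_nonempty_of_le (Finset.mem_Icc.mp hq).2 hL.1.2,
    fun p hp => ⟨hR.finite_ptsOfPeriod hε hp, ?_⟩⟩
  rw [hR.ncard_ptsOfPeriod hf hε hp]
  symm
  refine Finset.sum_subset (Finset.Icc_subset_Icc_right (Finset.mem_Icc.mp hL.1.1).2) ?_
  -- for `q > L` the matrix has the empty index type, so its trace is an empty sum
  intro q hq hqL
  have hempty : intersectingSets R q = ∅ := by
    by_contra hne
    exact hqL (Finset.mem_Icc.mpr ⟨(Finset.mem_Icc.mp hq).1,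
      hL.2 ⟨hq, Finset.nonempty_iff_ne_empty.mpr hne⟩⟩)
  have : IsEmpty (intersectingSets R q) := by
    rw [hempty]
    infer_instance
  rw [Matrix.trace_eq_zero_of_isEmpty, mul_zero]
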